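/- Let $G$ be an abelian (real, finite-dimensional) Lie group whose identity component $G^0$ has finite index in $G$. Let $S$ be a finitely generated subsemigroup of $G$ which is somewhere dense in $G$, i.e. its closure $\overline{S}$ contains a non-empty open subset of $G$. Then $\overline{S}$ is a subgroup of $G$ and $\overline{S}$ contains $G^0$. -/

import Mathlib

open scoped Manifold ContDiff

/-- The identity component `G⁰` of a Lie group, as a subgroup: Mathlib's
`Subgroup.connectedComponentOfOne`, whose carrier is `connectedComponent (1 : G)`. The topological
group structure it needs is the one that every Lie group carries. -/
def lieIdentityComponent {E : Type*} [NormedAddCommGroup E] [NormedSpace ℝ E]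
    {H : Type*} [TopologicalSpace H] (I : ModelWithCorners ℝ E H)
    (G : Type*) [TopologicalSpace G] [ChartedSpace H G] [Group G] [LieGroup I ∞ G] :
    Subgroup G :=
  @Subgroup.connectedComponentOfOne G _ _ (topologicalGroup_of_lieGroup I ∞)

/-!
Let `T` be the closure of `S`. If `1` is an interior point of `T`, then `T ∩ T⁻¹` is an open subgroup;
every open subgroup contains the identity component, so some positive power of each `x ∈ T` lies in
`T ∩ T⁻¹`, whence `x⁻¹ ∈ T`, and `T` is an open subgroup (`exists_subgroup_coe_eq_of_one_mem_interior`).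
So it must be shown that `1 ∈ interior T`, and only here does finite generation matter.

Suppose `1 ∉ interior T`. The interior of `T` is a semigroup, and Zorn's lemma enlarges it to a
semigroup `P` that is maximal among the open semigroups avoiding `1`. Such a `P` behaves like an open
half-space. It is the strict positive cone of a total order on a quotient of `G`: the non-negative
elements are those of `R = {x | x⁻¹ ∉ P}`, a submonoid with `R * P ⊆ P`
(`Maximal.mul_mem_of_inv_notMem`), and the subgroup divided out is `N = R ∩ R⁻¹`. Because open subgroups
of `G` have torsion quotient, the order is Archimedean (`Maximal.exists_pow_mul_inv_mem`) and the closed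
subgroup `N` has empty interior. The generators of `S` are all non-negative, since the inverse of one
that is not would outgrow the elements of `interior T` under multiplication by its powers. By the
Archimedean property, a generator in `P` can occur only boundedly often in an element of `S` below a
given bound `c`, while the other generators lie in `N`. Hence the part of `S` below `c` lies in finitely
many cosets of `N` and is nowhere dense, although it is dense in the nonempty open part of `interior T`
below `c` for suitable `c`.

The argument uses no chart: it holds in every commutative topological group whose identity component
has finite index.
-/

open scoped Topology Pointwise

/-! ### Maximal open semigroups avoiding the identity -/

section MaximalOpenSemigroup

theorem Subsemigroup.pow_mem_of_ne_zero {G : Type*} [Monoid G] {P : Subsemigroup G} {x : G}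
    (hx : x ∈ P) {k : ℕ} (hk : k ≠ 0) : x ^ k ∈ P := by
  obtain ⟨k, rfl⟩ := Nat.exists_eq_succ_of_ne_zero hk
  induction k with
  | zero => simpa using hx
  | succ k ih => rw [pow_succ]; exact mul_mem (ih k.succ_ne_zero) hx

variable {G : Type*} [TopologicalSpace G] [CommGroup G]

/-- An open subsemigroup that does not contain `1`. The maximal ones are the analogues of the open
half-spaces of a vector space. -/
def IsOpenAvoidingOne (P : Subsemigroup G) : Prop :=
  IsOpen (P : Set G) ∧ (1 : G) ∉ P

theorem IsOpenAvoidingOne.exists_maximal {Q : Subsemigroup G} (hQ : IsOpenAvoidingOne Q) :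
    ∃ P : Subsemigroup G, Q ≤ P ∧ Maximal IsOpenAvoidingOne P := by
  refine zorn_le_nonempty₀ {P : Subsemigroup G | IsOpenAvoidingOne P} ?_ Q hQ
  intro c hc hchain y hy
  have hmem : ∀ x : G, x ∈ sSup c ↔ ∃ s ∈ c, x ∈ s := fun x =>
    Subsemigroup.mem_sSup_of_directed_on hchain.directedOn
  refine ⟨sSup c, ⟨?_, ?_⟩, fun z hz => le_sSup hz⟩
  · have heq : ((sSup c : Subsemigroup G) : Set G) = ⋃ s ∈ c, (s : Set G) := by
      ext x
      simp [hmem]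
    rw [heq]
    exact isOpen_biUnion fun s hs => (hc hs).1
  · rw [hmem]
    rintro ⟨s, hs, h1⟩
    exact (hc hs).2 h1

variable {P : Subsemigroup G}

variable [IsTopologicalGroup G]

/-- The elements having a positive power in `P` form an open semigroup avoiding `1`, so a maximal `P`
already contains them. -/
theorem Maximal.mem_of_pow_mem (hP : Maximal IsOpenAvoidingOne P) {x : G} {k : ℕ} (hk : k ≠ 0)
    (hx : x ^ k ∈ P) : x ∈ P := by
  let Q : Subsemigroup G :=
    { carrier := {y | ∃ n : ℕ, n ≠ 0 ∧ y ^ n ∈ P}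
      mul_mem' := by
        rintro y z ⟨m, hm, hy⟩ ⟨n, hn, hz⟩
        refine ⟨m * n, mul_ne_zero hm hn, ?_⟩
        rw [mul_pow, pow_mul, mul_comm m n, pow_mul]
        exact mul_mem (Subsemigroup.pow_mem_of_ne_zero hy hn)
          (Subsemigroup.pow_mem_of_ne_zero hz hm) }
  have hQ : IsOpenAvoidingOne Q := by
    constructor
    · have heq : (Q : Set G) = ⋃ (n : ℕ) (_ : n ≠ 0), (fun y : G => y ^ n) ⁻¹' (P : Set G) := by
        ext y
        simp [Q]
      rw [heq]
      exact isOpen_biUnion fun n _ => hP.prop.1.preimage (continuous_pow n)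
    · rintro ⟨n, -, h⟩
      exact hP.prop.2 (by simpa using h)
  have hPQ : P ≤ Q := fun y hy => ⟨1, one_ne_zero, by simpa using hy⟩
  exact hP.le_of_ge hQ hPQ ⟨k, hk, hx⟩

/-- Totality of the preorder defined by a maximal `P`: an element whose inverse is not positive is
non-negative. Otherwise the translates of `P` by the powers of `x` would make up a larger open semigroup
avoiding `1`. -/
theorem Maximal.mul_mem_of_inv_notMem (hP : Maximal IsOpenAvoidingOne P) {x p : G} (hx : x⁻¹ ∉ P)
    (hp : p ∈ P) : x * p ∈ P := by
  let Q : Subsemigroup G :=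
    { carrier := {y | ∃ n : ℕ, (x ^ n)⁻¹ * y ∈ P}
      mul_mem' := by
        rintro y z ⟨m, hy⟩ ⟨n, hz⟩
        refine ⟨m + n, ?_⟩
        have heq : (x ^ (m + n))⁻¹ * (y * z) = ((x ^ m)⁻¹ * y) * ((x ^ n)⁻¹ * z) := by
          rw [pow_add, mul_inv, mul_mul_mul_comm]
        rw [heq]
        exact mul_mem hy hz }
  have hQ : IsOpenAvoidingOne Q := by
    constructor
    · have heq : (Q : Set G) = ⋃ n : ℕ, (fun y : G => (x ^ n)⁻¹ * y) ⁻¹' (P : Set G) := by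
        ext y
        simp [Q]
      rw [heq]
      exact isOpen_iUnion fun n => hP.prop.1.preimage (continuous_const_mul _)
    · rintro ⟨n, h⟩
      rw [mul_one, ← inv_pow] at h
      rcases eq_or_ne n 0 with rfl | hn
      · exact hP.prop.2 (by simpa using h)
      · exact hx (hP.mem_of_pow_mem hn h)
  have hPQ : P ≤ Q := fun y hy => ⟨0, by simpa using hy⟩
  exact hP.le_of_ge hQ hPQ ⟨1, by simpa using hp⟩

/-- The non-negative elements of the preorder defined by a maximal open semigroup `P` avoiding `1`:
those whose inverse is not in `P`. -/
def Maximal.nonnegSubmonoid (hP : Maximal IsOpenAvoidingOne P) : Submonoid G where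
  carrier := {x | x⁻¹ ∉ P}
  one_mem' := by simpa using hP.prop.2
  mul_mem' := by
    intro x y hx hy hxy
    refine hy ?_
    have h := hP.mul_mem_of_inv_notMem hx hxy
    rwa [mul_inv, mul_inv_cancel_left] at h

theorem Maximal.mem_nonnegSubmonoid (hP : Maximal IsOpenAvoidingOne P) {x : G} :
    x ∈ hP.nonnegSubmonoid ↔ x⁻¹ ∉ P :=
  Iff.rfl

theorem Maximal.le_nonnegSubmonoid (hP : Maximal IsOpenAvoidingOne P) {x : G} (hx : x ∈ P) :
    x ∈ hP.nonnegSubmonoid := fun h =>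
  hP.prop.2 (by simpa using mul_mem hx h)

/-- The elements that are neither positive nor negative for a maximal open semigroup `P` avoiding `1`:
the analogue of the hyperplane bounding a half-space. -/
def Maximal.boundarySubgroup (hP : Maximal IsOpenAvoidingOne P) : Subgroup G where
  toSubmonoid := hP.nonnegSubmonoid ⊓ hP.nonnegSubmonoid.comap (invMonoidHom : G →* G)
  inv_mem' := by
    rintro x ⟨h₁, h₂⟩
    exact ⟨h₂, by simpa using h₁⟩

theorem Maximal.mem_boundarySubgroup (hP : Maximal IsOpenAvoidingOne P) {x : G} :
    x ∈ hP.boundarySubgroup ↔ x⁻¹ ∉ P ∧ x ∉ P := by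
  have h : x ∈ hP.boundarySubgroup ↔ x⁻¹ ∉ P ∧ x⁻¹⁻¹ ∉ P := Iff.rfl
  rwa [inv_inv] at h

theorem Maximal.isClosed_boundarySubgroup (hP : Maximal IsOpenAvoidingOne P) :
    IsClosed (hP.boundarySubgroup : Set G) := by
  have heq : (hP.boundarySubgroup : Set G) = (Inv.inv ⁻¹' (P : Set G) ∪ (P : Set G))ᶜ := by
    ext x
    simp [hP.mem_boundarySubgroup]
  rw [heq]
  exact ((hP.prop.1.preimage continuous_inv).union hP.prop.1).isClosed_compl

theorem interior_closure_mul_mem {S : Subsemigroup G} {x y : G}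
    (hx : x ∈ interior (closure (S : Set G)))
    (hy : y ∈ closure (S : Set G)) : x * y ∈ interior (closure (S : Set G)) := by
  have hT : closure (S : Set G) * closure (S : Set G) ⊆ closure (S : Set G) := by
    rintro _ ⟨a, ha, b, hb, rfl⟩
    exact S.topologicalClosure.mul_mem ha hb
  exact interior_mono hT (subset_interior_mul_left (Set.mul_mem_mul hx hy))

/-! ### Groups in which open subgroups have torsion quotient -/

section Torsion

variable (htor : ∀ C : Subgroup G, IsOpen (C : Set G) → ∀ x : G, ∃ k : ℕ, k ≠ 0 ∧ x ^ k ∈ C)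
include htor

/-- The preorder defined by a maximal `P` is Archimedean: the elements bounded above and below by powers
of `p` form an open subgroup, so every element has a positive power among them. -/
theorem Maximal.exists_pow_mul_inv_mem (hP : Maximal IsOpenAvoidingOne P) {p : G} (hp : p ∈ P) (x : G) :
    ∃ n : ℕ, p ^ n * x⁻¹ ∈ P := by
  let C : Subgroup G :=
    { carrier := {y | ∃ n : ℕ, p ^ n * y⁻¹ ∈ P ∧ p ^ n * y ∈ P}
      one_mem' := ⟨1, by simpa using hp⟩
      mul_mem' := by
        rintro y z ⟨m, hy, hy'⟩ ⟨n, hz, hz'⟩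
        refine ⟨m + n, ?_, ?_⟩
        · rw [pow_add, mul_inv, mul_mul_mul_comm]
          exact mul_mem hy hz
        · rw [pow_add, mul_mul_mul_comm]
          exact mul_mem hy' hz'
      inv_mem' := by
        rintro y ⟨n, hy, hy'⟩
        exact ⟨n, by simpa using hy', hy⟩ }
  have hC : IsOpen (C : Set G) := by
    have heq : (C : Set G) = ⋃ n : ℕ, ((fun y : G => p ^ n * y⁻¹) ⁻¹' (P : Set G) ∩
        (fun y : G => p ^ n * y) ⁻¹' (P : Set G)) := by
      ext y
      simp [C]
    rw [heq]
    exact isOpen_iUnion fun n => (hP.prop.1.preimage (by fun_prop)).inter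
      (hP.prop.1.preimage (by fun_prop))
  obtain ⟨k, hk, n, hn, -⟩ := htor C hC x
  refine ⟨n, hP.mem_of_pow_mem hk ?_⟩
  have hpR : (p ^ n) ^ (k - 1) ∈ hP.nonnegSubmonoid :=
    pow_mem (pow_mem (hP.le_nonnegSubmonoid hp) n) _
  have heq : (p ^ n * x⁻¹) ^ k = (p ^ n) ^ (k - 1) * (p ^ n * (x ^ k)⁻¹) := by
    rw [← mul_assoc, ← pow_succ, Nat.sub_add_cancel (Nat.one_le_iff_ne_zero.mpr hk), mul_pow, inv_pow]
  rw [heq]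
  exact hP.mul_mem_of_inv_notMem hpR hn

theorem Maximal.isNowhereDense_boundarySubgroup (hP : Maximal IsOpenAvoidingOne P)
    (hne : (P : Set G).Nonempty) : IsNowhereDense (hP.boundarySubgroup : Set G) := by
  rw [hP.isClosed_boundarySubgroup.isNowhereDense_iff, Set.eq_empty_iff_forall_notMem]
  intro g hg
  obtain ⟨p, hp⟩ := hne
  obtain ⟨k, hk, hpk⟩ := htor _ (hP.boundarySubgroup.isOpen_of_mem_nhds
    (mem_interior_iff_mem_nhds.mp hg)) p
  exact (hP.mem_boundarySubgroup.mp hpk).2 (Subsemigroup.pow_mem_of_ne_zero hp hk)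

/-- Finitely many non-negative elements generate a monoid whose part below `c` meets only finitely many
cosets of the boundary subgroup: the exponents of the positive generators are bounded by the Archimedean
property, and the remaining generators lie in the boundary subgroup. -/
theorem Maximal.exists_finite_cosets (hP : Maximal IsOpenAvoidingOne P) (A : Finset G)
    (hA : ∀ a ∈ A, a ∈ hP.nonnegSubmonoid) (c : G) :
    ∃ F : Set G, F.Finite ∧ ∀ s ∈ Submonoid.closure (A : Set G), c * s⁻¹ ∈ P →
      ∃ f ∈ F, f⁻¹ * s ∈ hP.boundarySubgroup := by
  classical
  have hbd : ∀ i : A, ∃ n : ℕ, i.1 ∈ P → i.1 ^ n * c⁻¹ ∈ P := by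
    intro i
    by_cases hi : i.1 ∈ P
    · obtain ⟨n, hn⟩ := hP.exists_pow_mul_inv_mem htor hi c
      exact ⟨n, fun _ => hn⟩
    · exact ⟨0, fun h => absurd h hi⟩
  choose M hM using hbd
  refine ⟨(fun n : A → ℕ => ∏ i, i.1 ^ n i) '' Set.Iic M, (Set.finite_Iic M).image _, ?_⟩
  intro s hs hsc
  obtain ⟨n, rfl⟩ := Submonoid.mem_closure_finset'.mp hs
  refine ⟨_, ⟨fun i => if i.1 ∈ P then n i else 0, fun i => ?_, rfl⟩, ?_⟩
  · by_cases hi : i.1 ∈ P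
    · simp only [hi, if_true]
      by_contra! hlt
      -- If `M i < n i`, the product is both below `c` and above `i ^ M i`, which is itself above `c`.
      have hrest : i.1 ^ (n i - M i) * ∏ j ∈ Finset.univ.erase i, j.1 ^ n j ∈ hP.nonnegSubmonoid :=
        mul_mem (pow_mem (hA _ i.2) _) (prod_mem fun j _ => pow_mem (hA _ j.2) _)
      have habove := hP.mul_mem_of_inv_notMem hrest (hM i hi)
      have hprod : ∏ j : A, j.1 ^ n j = i.1 ^ (n i - M i) * i.1 ^ M i *
          ∏ j ∈ Finset.univ.erase i, j.1 ^ n j := by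
        rw [← pow_add, Nat.sub_add_cancel hlt.le,
          Finset.mul_prod_erase _ (fun j : A => j.1 ^ n j) (Finset.mem_univ i)]
      refine hP.prop.2 ?_
      convert mul_mem hsc habove using 1
      rw [hprod]
      generalize i.1 ^ (n i - M i) = x
      generalize i.1 ^ M i = y
      generalize ∏ j ∈ Finset.univ.erase i, j.1 ^ n j = z
      calc
        1 = (x * y * z)⁻¹ * (x * y * z) * (c * c⁻¹) := by
          rw [inv_mul_cancel, mul_inv_cancel, mul_one]
        _ = c * (x * y * z)⁻¹ * (x * z * (y * c⁻¹)) := by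
          simp only [mul_inv]
          ac_rfl
    · simp [hi]
  · rw [← Finset.prod_inv_distrib, ← Finset.prod_mul_distrib]
    refine prod_mem fun i _ => ?_
    by_cases hi : i.1 ∈ P
    · simp [hi, one_mem]
    · simpa [hi] using pow_mem (hP.mem_boundarySubgroup.mpr ⟨hA _ i.2, hi⟩) (n i)

/-! ### Somewhere dense subsemigroups -/

theorem one_mem_interior_closure (A : Finset G)
    (hS : (interior (closure (Subsemigroup.closure (A : Set G) : Set G))).Nonempty) :
    (1 : G) ∈ interior (closure (Subsemigroup.closure (A : Set G) : Set G)) := by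
  set S := Subsemigroup.closure (A : Set G) with hSdef
  by_contra h1
  let Q : Subsemigroup G :=
    { carrier := interior (closure (S : Set G))
      mul_mem' := fun hx hy => interior_closure_mul_mem hx (interior_subset hy) }
  obtain ⟨P, hQP, hP⟩ := IsOpenAvoidingOne.exists_maximal (Q := Q) ⟨isOpen_interior, h1⟩
  obtain ⟨u, hu⟩ := hS
  have huP : u ∈ P := hQP hu
  have hA : ∀ a ∈ A, a ∈ hP.nonnegSubmonoid := by
    intro a ha hneg
    obtain ⟨n, hn⟩ := hP.exists_pow_mul_inv_mem htor hneg u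
    have hmem : ∀ k : ℕ, u * a ^ k ∈ interior (closure (S : Set G)) := by
      intro k
      induction k with
      | zero => simpa using hu
      | succ k ih =>
        rw [pow_succ, ← mul_assoc]
        exact interior_closure_mul_mem ih (subset_closure (Subsemigroup.subset_closure ha))
    refine hP.prop.2 ?_
    convert mul_mem hn (hQP (hmem n)) using 1
    rw [inv_pow, mul_assoc, inv_mul_cancel_left, inv_mul_cancel]
  -- With the bound `u * u`, the point `u` itself lies in the part of `interior (closure S)` below it.
  obtain ⟨F, hF, hcos⟩ := hP.exists_finite_cosets htor A hA (u * u)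
  set V : Set G := interior (closure (S : Set G)) ∩ (fun x : G => u * u * x⁻¹) ⁻¹' (P : Set G) with hV
  have hVo : IsOpen V := isOpen_interior.inter (hP.prop.1.preimage (by fun_prop))
  have huV : u ∈ V := ⟨hu, by simpa using huP⟩
  set W : Set G := ⋃ f ∈ F, (fun x : G => f⁻¹ * x) ⁻¹' (hP.boundarySubgroup : Set G) with hW
  have hWc : IsClosed W :=
    hF.isClosed_biUnion fun f _ => hP.isClosed_boundarySubgroup.preimage (by fun_prop)
  have hSM : ∀ s ∈ S, s ∈ Submonoid.closure (A : Set G) := by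
    have hle : S ≤ (Submonoid.closure (A : Set G)).toSubsemigroup :=
      Subsemigroup.closure_le.mpr Submonoid.subset_closure
    exact fun s hs => hle hs
  have hVW : V ⊆ W := by
    have hsub : V ∩ S ⊆ W := by
      rintro s ⟨hsV, hsS⟩
      obtain ⟨f, hf, hfs⟩ := hcos s (hSM s hsS) hsV.2
      exact Set.mem_biUnion hf hfs
    exact fun x hx => hWc.closure_subset_iff.mpr hsub
      (hVo.inter_closure ⟨hx, interior_subset hx.1⟩)
  have hWe : interior W = ∅ := by
    have hN := hP.isNowhereDense_boundarySubgroup htor ⟨u, huP⟩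
    rw [hP.isClosed_boundarySubgroup.isNowhereDense_iff] at hN
    clear hVW hcos
    clear_value W
    subst hW
    clear hWc
    induction F, hF using Set.Finite.induction_on with
    | empty => simp
    | @insert f F _ hF ih =>
      rw [Set.biUnion_insert, interior_union_isClosed_of_interior_empty
        (hP.isClosed_boundarySubgroup.preimage (by fun_prop)) ih]
      have := (Homeomorph.mulLeft f⁻¹).preimage_interior (hP.boundarySubgroup : Set G)
      rw [hN, Set.preimage_empty] at this
      exact this.symm
  exact Set.notMem_empty u (hWe ▸ interior_maximal hVW hVo huV)

theorem exists_subgroup_coe_eq_of_one_mem_interior {S : Subsemigroup G}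
    (h1 : (1 : G) ∈ interior (closure (S : Set G))) :
    ∃ K : Subgroup G, IsOpen (K : Set G) ∧ (K : Set G) = closure (S : Set G) := by
  have h1' : (1 : G) ∈ S.topologicalClosure := interior_subset h1
  let T : Submonoid G :=
    { S.topologicalClosure with one_mem' := h1' }
  let K : Subgroup G :=
    { toSubmonoid := T ⊓ T.comap (invMonoidHom : G →* G)
      inv_mem' := by
        rintro x ⟨h₁, h₂⟩
        exact ⟨h₂, by simpa using h₁⟩ }
  have hnhds : closure (S : Set G) ∈ 𝓝 (1 : G) := mem_interior_iff_mem_nhds.mp h1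
  have hK : IsOpen (K : Set G) := by
    refine K.isOpen_of_mem_nhds (g := 1) (Filter.inter_mem hnhds ?_)
    rw [← inv_one] at hnhds
    exact continuous_inv.continuousAt.preimage_mem_nhds hnhds
  refine ⟨K, hK, Set.Subset.antisymm (fun x hx => hx.1) fun x hx => ?_⟩
  obtain ⟨k, hk, hxk⟩ := htor K hK x
  have hxT : x ∈ T := hx
  refine ⟨hx, ?_⟩
  have heq : x⁻¹ = x ^ (k - 1) * (x ^ k)⁻¹ := by
    obtain ⟨m, rfl⟩ := Nat.exists_eq_succ_of_ne_zero hk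
    rw [Nat.succ_sub_one, pow_succ, mul_inv, mul_inv_cancel_left]
  change x⁻¹ ∈ T
  rw [heq]
  exact mul_mem (pow_mem hxT _) hxk.2

end Torsion

end MaximalOpenSemigroup

theorem theorem2p1
    {E : Type*} [NormedAddCommGroup E] [NormedSpace ℝ E] [FiniteDimensional ℝ E]
    {H : Type*} [TopologicalSpace H] (I : ModelWithCorners ℝ E H) [I.Boundaryless]
    {G : Type*} [TopologicalSpace G] [ChartedSpace H G] [CommGroup G] [LieGroup I ∞ G]
    (hG : (lieIdentityComponent I G).FiniteIndex)
    (S : Subsemigroup G)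
    (hfg : ∃ A : Finset G, Subsemigroup.closure (A : Set G) = S)
    (hS : (interior (closure (S : Set G))).Nonempty) :
    ∃ K : Subgroup G, (K : Set G) = closure (S : Set G) ∧ lieIdentityComponent I G ≤ K := by
  have : IsTopologicalGroup G := topologicalGroup_of_lieGroup I ∞
  have hle : ∀ C : Subgroup G, IsOpen (C : Set G) → lieIdentityComponent I G ≤ C := fun C hC x hx =>
    IsClopen.connectedComponent_subset ⟨C.isClosed_of_isOpen hC, hC⟩ C.one_mem hx
  have htor : ∀ C : Subgroup G, IsOpen (C : Set G) → ∀ x : G, ∃ k : ℕ, k ≠ 0 ∧ x ^ k ∈ C :=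
    fun C hC x => ⟨_, hG.index_ne_zero, hle C hC (Subgroup.pow_index_mem _ x)⟩
  obtain ⟨A, rfl⟩ := hfg
  obtain ⟨K, hK, hKS⟩ :=
    exists_subgroup_coe_eq_of_one_mem_interior htor (one_mem_interior_closure htor A hS)
  exact ⟨K, hKS, hle K hK⟩
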